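/- Let $p,k\in\mathbb N$, let $\Theta\subset\mathbb R^k$, let $h\colon\Theta\to\mathbb R^p$ and $r\colon\Theta\to\mathbb R$ be functions, let $\theta_0\in\Theta$ and $\mu_0=h(\theta_0)$. For each sample size $n$ let $\hat\mu$ be a random vector in $\mathbb R^p$, let $\hat\sigma_1,\dots,\hat\sigma_p\ge 0$ be random variables, let $\hat W$ be a random symmetric $p\times p$ matrix, and let $\hat\theta$ be a random vector that (almost surely) minimizes $(\hat\mu-h(\theta))'\hat W(\hat\mu-h(\theta))$ over $\theta\in\Theta$. All limits are for $n\to\infty$. Assume: (i) $\sqrt n(\hat\mu-\mu_0)\stackrel{d}{\to}N(0,V)$ for a symmetric positive semidefinite matrix $V\neq 0$; (ii) $\sqrt n\,\hat\sigma_j\stackrel{p}{\to}V_{jj}^{1/2}$ for $j=1,\dots,p$; (iii) $\theta_0$ lies in the interior of $\Theta$, $h$ and $r$ are continuously differentiable in a neighborhood of $\theta_0$, $G=\partial h(\theta_0)/\partial\theta'$ has full column rank, and $\lambda=\partial r(\theta_0)/\partial\theta\neq 0$; (iv) $\hat\theta\stackrel{p}{\to}\theta_0$; (v) $\hat W\stackrel{p}{\to}W$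 for a symmetric positive semidefinite matrix $W$; (vi) $G'WG$ is nonsingular. Put $x=WG(G'WG)^{-1}\lambda$ and $\hat x=\hat W\hat G(\hat G'\hat W\hat G)^{-1}\hat\lambda$ with $\hat G=\partial h(\hat\theta)/\partial\theta'$ and $\hat\lambda=\partial r(\hat\theta)/\partial\theta$, and put $\widehat{\mathrm{se}}(\hat x)=\sum_{j=1}^p\hat\sigma_j|\hat x_j|$. Let $\mathcal S$ be the set of symmetric positive semidefinite $p\times p$ matrices $\tilde V$ with $\tilde V_{jj}=V_{jj}$ for all $j$, let $\Phi$ be the standard normal distribution function, and let $0<\alpha<1$. Then: (a) $\displaystyle \sqrt n\,\widehat{\mathrm{se}}(\hat x)\stackrel{p}{\to}\sum_{j=1}^p V_{jj}^{1/2}|x_j|=\max_{\tilde V\in\mathcal S}\sqrt{x'\tilde Vx}$, the worst-case asymptotic standard deviation of $r(\hat\theta)$. Suppose moreover that $\sum_{j=1}^p V_{jj}^{1/2}|x_j|>0$, and let $C_n=\left[r(\hat\theta)-\Phi^{-1}(1-\alpha/2)\,\widehat{\mathrm{se}}(\hat x),\; r(\hat\theta)+\Phi^{-1}(1-\alpha/2)\,\widehat{\mathrm{se}}(\hat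 x)\right]$. Then: (b) $\liminf_{n\to\infty}P(r(\theta_0)\in C_n)\ge 1-\alpha$. (c) $\lim_{n\to\infty}P(r(\theta_0)\in C_n)=1-\alpha$ whenever $V$ attains the maximum in (a); in particular whenever $V$ has the worst-case rank-one structure $V=ss'$ with $s\in\mathbb R^p$ and $s_jx_j\ge 0$ for all $j$, that is, when the components of $\hat\mu$ are asymptotically perfectly correlated, positively or negatively according to the signs of the entries of $x$. -/

import Mathlib

open MeasureTheory ProbabilityTheory Filter Topology Matrix

noncomputable section

/-- The quantile function `Φ⁻¹` of the standard normal distribution,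
`Φ⁻¹(u) = inf {z | u ≤ Φ(z)}` for `0 < u < 1`. -/
def stdNormalQuantile (u : ℝ) : ℝ :=
  sInf {z : ℝ | u ≤ cdf (gaussianReal 0 1) z}

/-- The Jacobian matrix `∂h(θ)/∂θ'`, with entries `∂hᵢ(θ)/∂θⱼ`. -/
def jacobianMatrix {k p : ℕ} (h : EuclideanSpace ℝ (Fin k) → EuclideanSpace ℝ (Fin p))
    (θ : EuclideanSpace ℝ (Fin k)) : Matrix (Fin p) (Fin k) ℝ :=
  Matrix.of fun i j => fderiv ℝ h θ (EuclideanSpace.single j 1) i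

/-- The vector of partial derivatives `∂r(θ)/∂θ`. -/
def gradientVector {k : ℕ} (r : EuclideanSpace ℝ (Fin k) → ℝ)
    (θ : EuclideanSpace ℝ (Fin k)) : Fin k → ℝ :=
  fun j => fderiv ℝ r θ (EuclideanSpace.single j 1)

/-- The vector `x = W G (G' W G)⁻¹ λ` of weights on the empirical moments. -/
def momentLoadings {k p : ℕ} (W : Matrix (Fin p) (Fin p) ℝ) (G : Matrix (Fin p) (Fin k) ℝ)
    (lam : Fin k → ℝ) : Fin p → ℝ :=
  (W * G * (Gᵀ * W * G)⁻¹) *ᵥ lam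

/-- The minimum distance objective `(m - h(θ))' W (m - h(θ))`. -/
def minDistObjective {k p : ℕ} (h : EuclideanSpace ℝ (Fin k) → EuclideanSpace ℝ (Fin p))
    (m : EuclideanSpace ℝ (Fin p)) (W : Matrix (Fin p) (Fin p) ℝ)
    (θ : EuclideanSpace ℝ (Fin k)) : ℝ :=
  (m - h θ).ofLp ⬝ᵥ (W *ᵥ (m - h θ).ofLp)

/-- The worst-case standard error `∑ⱼ σⱼ |xⱼ|`. -/
def worstCaseSE {p : ℕ} (σ x : Fin p → ℝ) : ℝ :=
  ∑ j, σ j * |x j|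

/-- The set of symmetric positive semidefinite matrices with the same diagonal as `V`. -/
def sameDiagPosSemidef {p : ℕ} (V : Matrix (Fin p) (Fin p) ℝ) : Set (Matrix (Fin p) (Fin p) ℝ) :=
  {V' | V'.PosSemidef ∧ ∀ j, V' j j = V j j}

/-- Worst-case rank-one structure of `V` relative to `x`: a random vector with variance `V` is
a multiple `s ξ` of one scalar variable `ξ` of unit variance, so that its components are
perfectly correlated, positively or negatively according to the signs of the entries of `x`. -/
def IsWorstCaseRankOne {p : ℕ} (V : Matrix (Fin p) (Fin p) ℝ) (x : Fin p → ℝ) : Prop :=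
  ∃ s : Fin p → ℝ, V = Matrix.vecMulVec s s ∧ ∀ j, 0 ≤ s j * x j

/-- The moment matching framework together with its regularity conditions, for the true moment
vector `h θ₀`. The hatted arguments are the estimators, indexed by the sample size `n`. Only the
values of `h` and `r` on the parameter space `Θ` matter. -/
structure MomentMatchingRegularity {Ω : Type*} [MeasurableSpace Ω] (P : Measure Ω)
    [IsProbabilityMeasure P] {k p : ℕ} (Θ : Set (EuclideanSpace ℝ (Fin k)))
    (θ₀ : EuclideanSpace ℝ (Fin k))
    (h : EuclideanSpace ℝ (Fin k) → EuclideanSpace ℝ (Fin p))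
    (r : EuclideanSpace ℝ (Fin k) → ℝ) (V W : Matrix (Fin p) (Fin p) ℝ)
    (μhat : ℕ → Ω → EuclideanSpace ℝ (Fin p)) (σhat : ℕ → Ω → Fin p → ℝ)
    (What : ℕ → Ω → Matrix (Fin p) (Fin p) ℝ)
    (θhat : ℕ → Ω → EuclideanSpace ℝ (Fin k)) : Prop where
  /-- The estimators are random variables. -/
  measurable_μhat : ∀ n, Measurable (μhat n)
  measurable_σhat : ∀ n j, Measurable fun ω => σhat n ω j
  measurable_What : ∀ n i j, Measurable fun ω => What n ω i j
  measurable_θhat : ∀ n, Measurable (θhat n)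
  /-- The weight matrices are symmetric and the standard errors are nonnegative. -/
  What_isSymm : ∀ n ω, (What n ω).IsSymm
  σhat_nonneg : ∀ n ω j, 0 ≤ σhat n ω j
  /-- `θhat n` minimizes the minimum distance objective over `Θ`. -/
  θhat_argmin : ∀ n, ∀ᵐ ω ∂P, θhat n ω ∈ Θ ∧
    IsMinOn (minDistObjective h (μhat n ω) (What n ω)) Θ (θhat n ω)
  /-- Asymptotic normality of the empirical moments, with `V` nonzero. -/
  V_posSemidef : V.PosSemidef
  V_ne_zero : V ≠ 0
  asymptotically_normal :
    TendstoInDistribution (fun (n : ℕ) ω => √(n : ℝ) • (μhat n ω - h θ₀)) atTop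
      (id : EuclideanSpace ℝ (Fin p) → EuclideanSpace ℝ (Fin p)) (fun _ => P)
      (multivariateGaussian 0 V)
  /-- Consistency of the standard errors of the individual moments. -/
  σhat_consistent : ∀ j,
    TendstoInMeasure P (fun (n : ℕ) ω => √(n : ℝ) * σhat n ω j) atTop (fun _ => √(V j j))
  /-- Smoothness and rank conditions. -/
  θ₀_interior : θ₀ ∈ interior Θ
  h_contDiffAt : ContDiffAt ℝ 1 h θ₀
  r_contDiffAt : ContDiffAt ℝ 1 r θ₀
  G_full_rank : LinearIndependent ℝ (jacobianMatrix h θ₀).col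
  gradient_ne_zero : gradientVector r θ₀ ≠ 0
  /-- Consistency of the estimator. -/
  θhat_consistent : TendstoInMeasure P θhat atTop (fun _ => θ₀)
  /-- Convergence of the weight matrices, entry by entry. -/
  W_posSemidef : W.PosSemidef
  What_consistent : ∀ i j,
    TendstoInMeasure P (fun n ω => What n ω i j) atTop (fun _ => W i j)
  /-- Nonsingularity of `G' W G`. -/
  nonsingular : IsUnit ((jacobianMatrix h θ₀)ᵀ * W * jacobianMatrix h θ₀).det

/-- The estimated worst-case standard error `se(xhat) = ∑ⱼ σhatⱼ |xhatⱼ|`, where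
`xhat = What Ghat (Ghat' What Ghat)⁻¹ λhat` and the derivatives are evaluated at `θhat`. -/
def estimatedSE {k p : ℕ} (h : EuclideanSpace ℝ (Fin k) → EuclideanSpace ℝ (Fin p))
    (r : EuclideanSpace ℝ (Fin k) → ℝ) (σhat : Fin p → ℝ) (What : Matrix (Fin p) (Fin p) ℝ)
    (θhat : EuclideanSpace ℝ (Fin k)) : ℝ :=
  worstCaseSE σhat (momentLoadings What (jacobianMatrix h θhat) (gradientVector r θhat))

/-- The confidence interval `r(θhat) ± Φ⁻¹(1 - α/2) se(xhat)`. -/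
def confInterval {k p : ℕ} (α : ℝ) (h : EuclideanSpace ℝ (Fin k) → EuclideanSpace ℝ (Fin p))
    (r : EuclideanSpace ℝ (Fin k) → ℝ) (σhat : Fin p → ℝ) (What : Matrix (Fin p) (Fin p) ℝ)
    (θhat : EuclideanSpace ℝ (Fin k)) : Set ℝ :=
  Set.Icc (r θhat - stdNormalQuantile (1 - α / 2) * estimatedSE h r σhat What θhat)
    (r θhat + stdNormalQuantile (1 - α / 2) * estimatedSE h r σhat What θhat)

end

/-! Write `u = m - h θ₀` for the moment error. The delta method here is deterministic. Expanding `h`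
in the first-order condition `G(θ)' W' (m - h θ) = 0` expresses `θ - θ₀` linearly in `u`, so `r θ -
r θ₀ = x'u + o(u)` along any filter on which `θ → θ₀` and `W' → W` (`minDist_sub_isLittleO`). This
is applied to `highProb P`, the filter of events whose probability tends to one. Tightness of the
limit law turns `o(√n u)` into a remainder vanishing in probability (`tendsto_zero_of_isLittleO`).

Hence `√n (r θhat - r θ₀)` is `x'Zₙ` plus a negligible term, with `Zₙ = √n (μhat - h θ₀)`
asymptotically `N(0, V)`, while `√n` times the standard error tends to `c = ∑ √Vⱼⱼ |xⱼ|`. Coverage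
is therefore squeezed between the events `|x'Zₙ| < t c` with `t < q` and `|x'Zₙ| ≤ t c` with `t >
q`, where `q = Φ⁻¹(1 - α/2)`. The portmanteau theorem bounds their probabilities. The triangle
inequality gives `√(x'Vx) ≤ c`, hence coverage at least `1 - α` in the limit; equality gives exact
coverage. -/

open Asymptotics

/-! ### Order estimates for matrix-vector products -/

section MatrixAsymptotics

variable {β ι κ : Type*} [Fintype ι] [Fintype κ] {l : Filter β}

/-- Matrix products are estimated in the sup norm, moments and parameters in the Euclidean norm; the
two are equivalent in finite dimension. -/
lemma isTheta_ofLp (v : β → EuclideanSpace ℝ ι) : (fun b => (v b).ofLp) =Θ[l] v :=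
  ⟨(PiLp.continuousLinearEquiv 2 ℝ fun _ : ι => ℝ).toContinuousLinearMap.isBigO_comp v l,
    (PiLp.continuousLinearEquiv 2 ℝ fun _ : ι => ℝ).isBigO_comp_rev v l⟩

lemma Asymptotics.IsBigO.apply_pi (v : β → ι → ℝ) (j : ι) : (fun b => v b j) =O[l] v :=
  .of_bound 1 <| .of_forall fun b => by simpa using norm_le_pi_norm (v b) j

lemma isBigO_mulVec {T : β → Matrix ι κ ℝ} {T₀ : Matrix ι κ ℝ} (hT : Tendsto T l (𝓝 T₀))
    (v : β → κ → ℝ) : (fun b => T b *ᵥ v b) =O[l] v := by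
  refine isBigO_pi.2 fun i => ?_
  simp only [mulVec, dotProduct]
  refine IsBigO.fun_sum fun j _ => ?_
  have h1 : (fun b => T b i j) =O[l] (fun _ => (1 : ℝ)) :=
    (tendsto_pi_nhds.1 (tendsto_pi_nhds.1 hT i) j).isBigO_one ℝ
  simpa using h1.mul (IsBigO.apply_pi (l := l) v j).norm_right

lemma isLittleO_mulVec {T : β → Matrix ι κ ℝ} (hT : Tendsto T l (𝓝 0))
    (v : β → κ → ℝ) : (fun b => T b *ᵥ v b) =o[l] v := by
  refine isLittleO_pi.2 fun i => ?_
  simp only [mulVec, dotProduct]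
  refine IsLittleO.fun_sum fun j _ => ?_
  have h1 : (fun b => T b i j) =o[l] (fun _ => (1 : ℝ)) :=
    (isLittleO_one_iff ℝ).2 (tendsto_pi_nhds.1 (tendsto_pi_nhds.1 hT i) j)
  simpa using h1.mul_isBigO (IsBigO.apply_pi (l := l) v j).norm_right

lemma isBigO_dotProduct_left (a : ι → ℝ) (v : β → ι → ℝ) :
    (fun b => a ⬝ᵥ v b) =O[l] v := by
  simp only [dotProduct]
  exact IsBigO.fun_sum fun j _ => (IsBigO.apply_pi v j).const_mul_left _

end MatrixAsymptotics

/-! ### Jacobians, gradients and the first-order condition -/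

section Derivatives

variable {k p : ℕ} {h : EuclideanSpace ℝ (Fin k) → EuclideanSpace ℝ (Fin p)}
  {r : EuclideanSpace ℝ (Fin k) → ℝ} {θ θ₀ : EuclideanSpace ℝ (Fin k)}

lemma jacobianMatrix_mulVec (d : EuclideanSpace ℝ (Fin k)) :
    jacobianMatrix h θ *ᵥ d.ofLp = (fderiv ℝ h θ d).ofLp := by
  have hd : d = ∑ j, d j • EuclideanSpace.single j (1 : ℝ) := by
    ext i
    simp [Finset.sum_apply, Pi.single_apply]
  ext i
  conv_rhs => rw [hd, map_sum]
  simp [mulVec, dotProduct, jacobianMatrix, mul_comm]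

lemma gradientVector_dotProduct (d : EuclideanSpace ℝ (Fin k)) :
    gradientVector r θ ⬝ᵥ d.ofLp = fderiv ℝ r θ d := by
  have hd : d = ∑ j, d j • EuclideanSpace.single j (1 : ℝ) := by
    ext i
    simp [Finset.sum_apply, Pi.single_apply]
  conv_rhs => rw [hd, map_sum]
  simp [dotProduct, gradientVector, mul_comm]

lemma ContDiffAt.continuousAt_jacobianMatrix (hh : ContDiffAt ℝ 1 h θ₀) :
    ContinuousAt (jacobianMatrix h) θ₀ := by
  have h1 : ContinuousAt (fderiv ℝ h) θ₀ := hh.continuousAt_fderiv (by simp)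
  refine continuousAt_pi.2 fun i => continuousAt_pi.2 fun j => ?_
  have h2 : ContinuousAt (fun θ => fderiv ℝ h θ (EuclideanSpace.single j 1)) θ₀ :=
    h1.clm_apply continuousAt_const
  exact ((EuclideanSpace.proj i : EuclideanSpace ℝ (Fin p) →L[ℝ] ℝ).continuous.continuousAt).comp h2

lemma ContDiffAt.continuousAt_gradientVector (hr : ContDiffAt ℝ 1 r θ₀) :
    ContinuousAt (gradientVector r) θ₀ := by
  have h1 : ContinuousAt (fderiv ℝ r) θ₀ := hr.continuousAt_fderiv (by simp)
  exact continuousAt_pi.2 fun j => h1.clm_apply continuousAt_const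

/-- First-order condition of the minimum distance problem at an interior minimizer. -/
lemma jacobianMatrix_transpose_mulVec_eq_zero {m : EuclideanSpace ℝ (Fin p)}
    {W : Matrix (Fin p) (Fin p) ℝ} (hW : W.IsSymm) (hh : DifferentiableAt ℝ h θ)
    (hmin : IsLocalMin (minDistObjective h m W) θ) :
    (jacobianMatrix h θ)ᵀ *ᵥ (W *ᵥ (m - h θ).ofLp) = 0 := by
  let B : EuclideanSpace ℝ (Fin p) →L[ℝ] EuclideanSpace ℝ (Fin p) := toEuclideanCLM (𝕜 := ℝ) W
  have hB : ∀ u v : EuclideanSpace ℝ (Fin p), inner ℝ u (B v) = u.ofLp ⬝ᵥ (W *ᵥ v.ofLp) :=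
    fun u v => inner_toEuclideanCLM ..
  have hsymm : ∀ u v : Fin p → ℝ, u ⬝ᵥ (W *ᵥ v) = v ⬝ᵥ (W *ᵥ u) := fun u v => by
    rw [dotProduct_mulVec, ← mulVec_transpose, hW.eq, dotProduct_comm]
  have hd : HasFDerivAt (fun t => m - h t) (-fderiv ℝ h θ) θ := hh.hasFDerivAt.const_sub m
  have hf := hd.inner ℝ (B.hasFDerivAt.comp θ hd)
  -- Read as an inner product, the objective is differentiated by the product rule; symmetry of `W`
  -- makes the two resulting terms equal.
  have hobj : (fun t => inner ℝ (m - h t) ((B ∘ fun t => m - h t) t)) = minDistObjective h m W := by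
    ext t
    exact hB _ _
  rw [hobj] at hf
  have h0 := hmin.hasFDerivAt_eq_zero hf
  have key : ∀ v : EuclideanSpace ℝ (Fin k),
      v.ofLp ⬝ᵥ ((jacobianMatrix h θ)ᵀ *ᵥ (W *ᵥ (m - h θ).ofLp)) = 0 := fun v => by
    have h1 := DFunLike.congr_fun h0 v
    simp only [ContinuousLinearMap.comp_apply, ContinuousLinearMap.prod_apply,
      fderivInnerCLM_apply, _root_.neg_apply, map_neg,
      inner_neg_right, Function.comp_apply, hB, _root_.zero_apply] at h1
    rw [hsymm (m - h θ).ofLp, WithLp.ofLp_neg, neg_dotProduct] at h1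
    rw [dotProduct_mulVec, ← mulVec_transpose, transpose_transpose, jacobianMatrix_mulVec]
    linarith
  exact dotProduct_eq_zero _ fun w => by simpa [dotProduct_comm] using key (WithLp.toLp 2 w)

end Derivatives

/-! ### Linearization of the minimum distance estimator -/

section MinimumDistance

variable {β : Type*} {l : Filter β} {k p : ℕ}
  {h : EuclideanSpace ℝ (Fin k) → EuclideanSpace ℝ (Fin p)}
  {r : EuclideanSpace ℝ (Fin k) → ℝ} {θ₀ : EuclideanSpace ℝ (Fin k)}
  {W : Matrix (Fin p) (Fin p) ℝ} {θ : β → EuclideanSpace ℝ (Fin k)}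
  {W' : β → Matrix (Fin p) (Fin p) ℝ} {m : β → EuclideanSpace ℝ (Fin p)}

/-- By Cramer's rule the inverse is the adjugate over the determinant; both are polynomial in the
entries, and the limiting determinant is nonzero. -/
lemma tendsto_matrix_inv {ι : Type*} [Fintype ι] [DecidableEq ι] {A : β → Matrix ι ι ℝ}
    {A₀ : Matrix ι ι ℝ} (hA : Tendsto A l (𝓝 A₀)) (h₀ : IsUnit A₀.det) :
    Tendsto (fun b => (A b)⁻¹) l (𝓝 A₀⁻¹) := by
  have hdet : Tendsto (fun b => (A b).det) l (𝓝 A₀.det) :=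
    (continuous_id.matrix_det.tendsto A₀).comp hA
  have hadj : Tendsto (fun b => (A b).adjugate) l (𝓝 A₀.adjugate) :=
    (continuous_id.matrix_adjugate.tendsto A₀).comp hA
  simp only [Matrix.inv_def, Ring.inverse_eq_inv']
  exact (hdet.inv₀ h₀.ne_zero).smul hadj

lemma tendsto_matrix_mul {ι κ ν : Type*} [Fintype κ] {A : β → Matrix ι κ ℝ}
    {B : β → Matrix κ ν ℝ} {A₀ : Matrix ι κ ℝ} {B₀ : Matrix κ ν ℝ}
    (hA : Tendsto A l (𝓝 A₀)) (hB : Tendsto B l (𝓝 B₀)) :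
    Tendsto (fun b => A b * B b) l (𝓝 (A₀ * B₀)) :=
  ((continuous_fst.matrix_mul continuous_snd).tendsto (A₀, B₀)).comp (hA.prodMk_nhds hB)

lemma tendsto_matrix_transpose {ι κ : Type*} {A : β → Matrix ι κ ℝ} {A₀ : Matrix ι κ ℝ}
    (hA : Tendsto A l (𝓝 A₀)) : Tendsto (fun b => (A b)ᵀ) l (𝓝 A₀ᵀ) :=
  (continuous_id.matrix_transpose.tendsto A₀).comp hA

lemma tendsto_matrix_mulVec {ι κ : Type*} [Fintype κ] {A : β → Matrix ι κ ℝ} {A₀ : Matrix ι κ ℝ}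
    {v : β → κ → ℝ} {v₀ : κ → ℝ} (hA : Tendsto A l (𝓝 A₀)) (hv : Tendsto v l (𝓝 v₀)) :
    Tendsto (fun b => A b *ᵥ v b) l (𝓝 (A₀ *ᵥ v₀)) :=
  ((continuous_fst.matrix_mulVec continuous_snd).tendsto (A₀, v₀)).comp (hA.prodMk_nhds hv)

lemma tendsto_momentLoadings {G' : β → Matrix (Fin p) (Fin k) ℝ} {G : Matrix (Fin p) (Fin k) ℝ}
    {lam' : β → Fin k → ℝ} {lam : Fin k → ℝ} (hW : Tendsto W' l (𝓝 W)) (hG : Tendsto G' l (𝓝 G))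
    (hlam : Tendsto lam' l (𝓝 lam)) (hns : IsUnit (Gᵀ * W * G).det) :
    Tendsto (fun b => momentLoadings (W' b) (G' b) (lam' b)) l (𝓝 (momentLoadings W G lam)) := by
  have h1 : Tendsto (fun b => W' b * G' b) l (𝓝 (W * G)) := tendsto_matrix_mul hW hG
  have h2 : Tendsto (fun b => (G' b)ᵀ * W' b * G' b) l (𝓝 (Gᵀ * W * G)) :=
    tendsto_matrix_mul (tendsto_matrix_mul (tendsto_matrix_transpose hG) hW) hG
  have h3 := tendsto_matrix_inv h2 hns
  have h4 := tendsto_matrix_mul h1 h3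
  exact tendsto_matrix_mulVec h4 hlam

/-- Linearization of a smooth function of the minimum distance estimator in the moments. -/
theorem minDist_sub_isLittleO (hh : ContDiffAt ℝ 1 h θ₀) (hr : ContDiffAt ℝ 1 r θ₀)
    (hWsymm : W.IsSymm)
    (hns : IsUnit ((jacobianMatrix h θ₀)ᵀ * W * jacobianMatrix h θ₀).det)
    (hθ : Tendsto θ l (𝓝 θ₀)) (hW : Tendsto W' l (𝓝 W))
    (hfoc : ∀ᶠ b in l,
      (jacobianMatrix h (θ b))ᵀ *ᵥ (W' b *ᵥ (m b - h (θ b)).ofLp) = 0) :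
    (fun b => r (θ b) - r θ₀ -
      momentLoadings W (jacobianMatrix h θ₀) (gradientVector r θ₀) ⬝ᵥ (m b - h θ₀).ofLp) =o[l]
      (fun b => m b - h θ₀) := by
  set G := jacobianMatrix h θ₀ with hGdef
  set lam := gradientVector r θ₀ with hlam
  -- Substituting `h θ = h θ₀ + G d + ρ` into `B (m - h θ) = 0` gives `B G d = B (u - ρ)`, that is
  -- `d = T (u - ρ)`. The product `B G` mixes the Jacobians at `θ` and at `θ₀`, but still tends to
  -- `G'WG`.
  let B : β → Matrix (Fin k) (Fin p) ℝ := fun b => (jacobianMatrix h (θ b))ᵀ * W' b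
  let T : β → Matrix (Fin k) (Fin p) ℝ := fun b => (B b * G)⁻¹ * B b
  let T₀ : Matrix (Fin k) (Fin p) ℝ := (Gᵀ * W * G)⁻¹ * (Gᵀ * W)
  let d : β → EuclideanSpace ℝ (Fin k) := fun b => θ b - θ₀
  let ρ : β → EuclideanSpace ℝ (Fin p) := fun b => h (θ b) - h θ₀ - fderiv ℝ h θ₀ (d b)
  let u : β → EuclideanSpace ℝ (Fin p) := fun b => m b - h θ₀
  have hB : Tendsto B l (𝓝 (Gᵀ * W)) := tendsto_matrix_mul
    (tendsto_matrix_transpose (hh.continuousAt_jacobianMatrix.tendsto.comp hθ)) hW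
  have hBG : Tendsto (fun b => B b * G) l (𝓝 (Gᵀ * W * G)) :=
    tendsto_matrix_mul hB tendsto_const_nhds
  have hT : Tendsto T l (𝓝 T₀) := tendsto_matrix_mul (tendsto_matrix_inv hBG hns) hB
  have hunit : ∀ᶠ b in l, IsUnit (B b * G).det := by
    have h1 : Tendsto (fun b => (B b * G).det) l (𝓝 (Gᵀ * W * G).det) :=
      (continuous_id.matrix_det.tendsto _).comp hBG
    filter_upwards [h1.eventually_ne hns.ne_zero] with b hb using isUnit_iff_ne_zero.2 hb
  have hρ : ρ =o[l] d :=
    ((hh.differentiableAt one_ne_zero).hasFDerivAt.isLittleO).comp_tendsto hθ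
  have hd_eq : ∀ᶠ b in l, (d b).ofLp = T b *ᵥ (u b - ρ b).ofLp := by
    filter_upwards [hfoc, hunit] with b hb hub
    have h1 : (u b - ρ b).ofLp = (m b - h (θ b)).ofLp + G *ᵥ (d b).ofLp := by
      rw [hGdef, jacobianMatrix_mulVec, ← WithLp.ofLp_add]
      congr 1
      simp only [u, ρ]
      abel
    have h2 : B b *ᵥ (m b - h (θ b)).ofLp = 0 := by rw [← hb, mulVec_mulVec]
    rw [h1]
    simp only [T]
    rw [← mulVec_mulVec, mulVec_add, h2, zero_add, mulVec_mulVec, mulVec_mulVec,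
      Matrix.mul_assoc, Matrix.nonsing_inv_mul _ hub, one_mulVec]
  have hd_uρ : d =O[l] (fun b => u b - ρ b) := by
    refine (isTheta_ofLp d).2.trans (IsBigO.trans ?_ (isTheta_ofLp fun b => u b - ρ b).1)
    exact (isBigO_mulVec hT _).congr' (hd_eq.mono fun b hb => hb.symm) .rfl
  -- Absorption: `ρ = o(d)` and `d = O(u - ρ)`, so `ρ` is negligible against `u - ρ` and `u = ρ + (u
  -- - ρ)` has the order of `u - ρ`. Convergence of `m` is not needed.
  have huρ : (fun b => u b - ρ b) =O[l] u := by
    have h1 : ρ =o[l] (fun b => u b - ρ b) := hρ.trans_isBigO hd_uρ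
    simpa using! h1.right_isBigO_add
  have hd : d =O[l] u := hd_uρ.trans huρ
  have hρu : ρ =o[l] u := hρ.trans_isBigO hd
  have hr' : (fun b => r (θ b) - r θ₀ - fderiv ℝ r θ₀ (d b)) =o[l] u :=
    (((hr.differentiableAt one_ne_zero).hasFDerivAt.isLittleO).comp_tendsto hθ).trans_isBigO hd
  have hx : ∀ v : Fin p → ℝ, momentLoadings W G lam ⬝ᵥ v = lam ⬝ᵥ (T₀ *ᵥ v) := fun v => by
    have ht : (W * G * (Gᵀ * W * G)⁻¹)ᵀ = T₀ := by
      simp only [T₀, transpose_mul, transpose_nonsing_inv, transpose_transpose, hWsymm.eq,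
        Matrix.mul_assoc]
    rw [momentLoadings, ← ht, mulVec_transpose, dotProduct_comm, dotProduct_mulVec,
      dotProduct_comm]
  have hT0 : Tendsto (fun b => T b - T₀) l (𝓝 0) := by simpa using hT.sub_const T₀
  have h1 : (fun b => lam ⬝ᵥ ((T b - T₀) *ᵥ (u b).ofLp)) =o[l] u :=
    ((isBigO_dotProduct_left lam _).trans_isLittleO (isLittleO_mulVec hT0 _)).trans_isBigO
      (isTheta_ofLp u).1
  have h2 : (fun b => lam ⬝ᵥ (T b *ᵥ (ρ b).ofLp)) =o[l] u :=
    ((isBigO_dotProduct_left lam _).trans ((isBigO_mulVec hT _).trans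
      (isTheta_ofLp ρ).1)).trans_isLittleO hρu
  -- From `d = T (u - ρ)`: `λ'd - x'u = λ'(T - T₀)u - λ'Tρ`.
  refine ((hr'.add h1).sub h2).congr' ?_ .rfl
  filter_upwards [hd_eq] with b hb
  rw [← gradientVector_dotProduct, hb, hx, WithLp.ofLp_sub, mulVec_sub, sub_mulVec,
    dotProduct_sub, dotProduct_sub]
  ring

end MinimumDistance

/-! ### The worst-case standard deviation -/

section WorstCase

variable {p : ℕ} {V : Matrix (Fin p) (Fin p) ℝ} {x : Fin p → ℝ}

lemma dotProduct_vecMulVec_mulVec_self (s x : Fin p → ℝ) :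
    x ⬝ᵥ (vecMulVec s s *ᵥ x) = (s ⬝ᵥ x) ^ 2 := by
  rw [vecMulVec_mulVec, op_smul_eq_smul, dotProduct_smul, dotProduct_comm x s, smul_eq_mul, sq]

open scoped MatrixOrder in
/-- The standard deviation of `x'Z` is at most the sum of those of the `xⱼ Zⱼ`. -/
lemma sqrt_quadraticForm_le_worstCaseSE (hV : V.PosSemidef) :
    √(x ⬝ᵥ (V *ᵥ x)) ≤ worstCaseSE (fun j => √(V j j)) x := by
  -- With `V = B'B`, `√(v'Vv)` is the norm of `B v`. The columns of `B` have norms `√Vⱼⱼ`, and `B x`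
  -- is their combination with weights `xⱼ`.
  obtain ⟨B, rfl⟩ := CStarAlgebra.nonneg_iff_eq_star_mul_self.mp hV.nonneg
  rw [star_eq_conjTranspose]
  have hq : ∀ v : Fin p → ℝ, √(v ⬝ᵥ ((Bᴴ * B) *ᵥ v)) = ‖WithLp.toLp 2 (B *ᵥ v)‖ := fun v => by
    rw [EuclideanSpace.norm_eq, ← mulVec_mulVec, dotProduct_mulVec, vecMul_conjTranspose]
    simp [dotProduct, sq]
  have hd : ∀ j, (Bᴴ * B) j j = Pi.single j 1 ⬝ᵥ ((Bᴴ * B) *ᵥ Pi.single j 1) := fun j => by simp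
  have hx : WithLp.toLp 2 (B *ᵥ x) = ∑ j, x j • WithLp.toLp 2 (B *ᵥ Pi.single j 1) := by
    ext i
    simp [mulVec, dotProduct, mul_comm]
  rw [hq, hx, worstCaseSE]
  refine (norm_sum_le _ _).trans (Finset.sum_le_sum fun j _ => ?_)
  rw [hd, hq, norm_smul, Real.norm_eq_abs, mul_comm]

/-- The quadratic form is `(s'x)²`, and the sign condition rules out cancellation in `s'x`. -/
lemma sqrt_quadraticForm_eq_of_isWorstCaseRankOne (h : IsWorstCaseRankOne V x) :
    √(x ⬝ᵥ (V *ᵥ x)) = worstCaseSE (fun j => √(V j j)) x := by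
  obtain ⟨s, rfl, hs⟩ := h
  have h0 : 0 ≤ s ⬝ᵥ x := Finset.sum_nonneg fun j _ => hs j
  rw [dotProduct_vecMulVec_mulVec_self, Real.sqrt_sq h0, worstCaseSE, dotProduct]
  refine Finset.sum_congr rfl fun j _ => ?_
  rw [vecMulVec_apply, Real.sqrt_mul_self_eq_abs, ← abs_mul, abs_of_nonneg (hs j)]

theorem isGreatest_worstCaseSE (hV : V.PosSemidef) :
    IsGreatest ((fun V' => √(x ⬝ᵥ (V' *ᵥ x))) '' sameDiagPosSemidef V)
      (worstCaseSE (fun j => √(V j j)) x) := by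
  have hdiag : ∀ {V' : Matrix (Fin p) (Fin p) ℝ}, (∀ j, V' j j = V j j) →
      worstCaseSE (fun j => √(V' j j)) x = worstCaseSE (fun j => √(V j j)) x :=
    fun h => by simp only [h]
  refine ⟨?_, ?_⟩
  -- The sign at `xⱼ = 0` is taken to be `1`, not `0`, so that `sⱼ² = Vⱼⱼ` holds there too.
  · let s : Fin p → ℝ := fun j => √(V j j) * if 0 ≤ x j then 1 else -1
    have hs : ∀ j, vecMulVec s s j j = V j j := fun j => by
      have h0 : √(V j j) * √(V j j) = V j j := Real.mul_self_sqrt hV.diag_nonneg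
      simp only [vecMulVec_apply, s]
      split_ifs <;> linarith
    refine ⟨vecMulVec s s, ⟨by simpa using posSemidef_vecMulVec_self_star s, hs⟩, ?_⟩
    rw [← hdiag hs]
    refine sqrt_quadraticForm_eq_of_isWorstCaseRankOne ⟨s, rfl, fun j => ?_⟩
    simp only [s]
    split_ifs with hx
    · simpa using mul_nonneg (Real.sqrt_nonneg _) hx
    · nlinarith [Real.sqrt_nonneg (V j j)]
  · rintro _ ⟨V', ⟨hV', hd⟩, rfl⟩
    exact (sqrt_quadraticForm_le_worstCaseSE hV').trans_eq (hdiag hd)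

end WorstCase

/-! ### Standard normal quantiles and Gaussian linear forms -/

section StandardNormal

instance nullSingletonClass_stdNormal : NullSingletonClass (gaussianReal 0 1) :=
  nullSingletonClass_gaussianReal one_ne_zero

lemma continuous_cdf (μ : Measure ℝ) [IsProbabilityMeasure μ] [NullSingletonClass μ] :
    Continuous (cdf μ) := by
  refine continuous_iff_continuousAt.2 fun a => ?_
  rw [(monotone_cdf μ).continuousAt_iff_leftLim_eq_rightLim, StieltjesFunction.rightLim_eq]
  have h := (cdf μ).measure_singleton a
  rw [measure_cdf, measure_singleton, eq_comm, ENNReal.ofReal_eq_zero] at h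
  exact le_antisymm ((monotone_cdf μ).leftLim_le le_rfl) (by linarith)

lemma cdf_stdNormal_neg (t : ℝ) :
    cdf (gaussianReal 0 1) (-t) = 1 - cdf (gaussianReal 0 1) t := by
  have hmap : (gaussianReal 0 1).map (fun z => -z) = gaussianReal 0 1 := by
    simpa using gaussianReal_map_neg (μ := 0) (v := 1)
  rw [cdf_eq_real, cdf_eq_real]
  conv_lhs => rw [← hmap]
  rw [map_measureReal_apply measurable_neg measurableSet_Iic]
  have h1 : (fun z : ℝ => -z) ⁻¹' Set.Iic (-t) = Set.Ici t := by ext; simp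
  rw [h1, measureReal_congr Ioi_ae_eq_Ici.symm, ← Set.compl_Iic,
    probReal_compl_eq_one_sub measurableSet_Iic]

lemma stdNormal_real_Ioo (t : ℝ) (ht : 0 ≤ t) :
    (gaussianReal 0 1).real (Set.Ioo (-t) t) = 2 * cdf (gaussianReal 0 1) t - 1 := by
  rw [measureReal_congr Ioo_ae_eq_Ioc, ← Set.Iic_sdiff_Iic,
    measureReal_sdiff (Set.Iic_subset_Iic.2 (by linarith)) measurableSet_Iic,
    ← cdf_eq_real, ← cdf_eq_real, cdf_stdNormal_neg]
  ring

lemma cdf_stdNormalQuantile {u : ℝ} (hu : u ∈ Set.Ioo (0 : ℝ) 1) :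
    cdf (gaussianReal 0 1) (stdNormalQuantile u) = u := by
  set F := cdf (gaussianReal 0 1)
  have hF : Continuous F := continuous_cdf _
  have hne : {z : ℝ | u ≤ F z}.Nonempty :=
    ((tendsto_cdf_atTop (gaussianReal 0 1)).eventually_const_le hu.2).exists
  have hbdd : BddBelow {z : ℝ | u ≤ F z} := by
    obtain ⟨a, ha⟩ := ((tendsto_cdf_atBot (gaussianReal 0 1)).eventually_lt_const hu.1).exists
    refine ⟨a, fun z hz => ?_⟩
    by_contra! hza
    exact absurd (hz.trans (monotone_cdf _ hza.le)) (not_le.2 ha)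
  refine le_antisymm ?_ ((isClosed_le continuous_const hF).csInf_mem hne hbdd)
  -- If `F` exceeded `u` at the infimum, continuity would put a smaller point into the set.
  by_contra! hlt
  have h1 : ∀ᶠ z in 𝓝[<] (stdNormalQuantile u), u < F z :=
    (hF.tendsto _).mono_left nhdsWithin_le_nhds |>.eventually_const_lt hlt
  obtain ⟨z, hz, hzq⟩ := (h1.and self_mem_nhdsWithin).exists
  exact absurd (csInf_le hbdd (show u ≤ F z from hz.le)) (not_le.2 hzq)

lemma stdNormalQuantile_pos {α : ℝ} (hα : α ∈ Set.Ioo (0 : ℝ) 1) :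
    0 < stdNormalQuantile (1 - α / 2) := by
  have h1 := cdf_stdNormalQuantile (u := 1 - α / 2) ⟨by linarith [hα.2], by linarith [hα.1]⟩
  have h0 : cdf (gaussianReal 0 1) 0 = 1 / 2 := by
    have := cdf_stdNormal_neg 0
    rw [neg_zero] at this
    linarith
  by_contra! hq
  have := monotone_cdf (gaussianReal 0 1) hq
  linarith [hα.2]

/-- A linear form of a Gaussian vector is Gaussian, so mean and variance identify its law. Writing
that law as a scaled standard normal also covers `x'Vx = 0`. -/
lemma multivariateGaussian_map_dotProduct {p : ℕ} {V : Matrix (Fin p) (Fin p) ℝ}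
    (hV : V.PosSemidef) (x : Fin p → ℝ) :
    (multivariateGaussian 0 V).map (fun z => x ⬝ᵥ z.ofLp) =
      (gaussianReal 0 1).map (fun z => √(x ⬝ᵥ (V *ᵥ x)) * z) := by
  have hq : 0 ≤ x ⬝ᵥ (V *ᵥ x) := by simpa using hV.dotProduct_mulVec_nonneg x
  have hL : (fun z : EuclideanSpace ℝ (Fin p) => x ⬝ᵥ z.ofLp) =
      innerSL ℝ (WithLp.toLp 2 x) := by
    ext z
    simp [PiLp.inner_apply, dotProduct, mul_comm]
  have hvar : Var[innerSL ℝ (WithLp.toLp 2 x); multivariateGaussian 0 V] = x ⬝ᵥ (V *ᵥ x) := by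
    have h := covarianceBilin_multivariateGaussian (μ := 0) hV (WithLp.toLp 2 x) (WithLp.toLp 2 x)
    rw [covarianceBilin_self IsGaussian.memLp_two_id] at h
    exact h
  have hmean : ∫ z, innerSL ℝ (WithLp.toLp 2 x) z ∂(multivariateGaussian 0 V) = 0 := by
    rw [ContinuousLinearMap.integral_comp_id_comm IsGaussian.integrable_id]
    simp
  rw [gaussianReal_map_const_mul, hL, IsGaussian.map_eq_gaussianReal, hmean, hvar, mul_zero,
    mul_one]
  congr 1
  ext
  simp [Real.sq_sqrt hq, hq]

end StandardNormal

/-! ### Convergence in probability as convergence along a filter -/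

section HighProbability

variable {Ω : Type*} [MeasurableSpace Ω]

/-- The filter on `ℕ × Ω` of the events whose probability tends to one as `n → ∞`.
Convergence in probability to a constant is convergence along this filter. -/
def highProb (P : Measure Ω) : Filter (ℕ × Ω) where
  sets := {S | Tendsto (fun n => P {ω | (n, ω) ∉ S}) atTop (𝓝 0)}
  univ_sets := by simp
  sets_of_superset := fun {S T} hS hST =>
    tendsto_of_tendsto_of_tendsto_of_le_of_le tendsto_const_nhds hS (fun _ => zero_le)
      fun n => measure_mono fun ω hω h => hω (hST h)
  inter_sets := fun {S T} hS hT => by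
    have h := Tendsto.add (show Tendsto _ _ _ from hS) (show Tendsto _ _ _ from hT)
    rw [add_zero] at h
    refine tendsto_of_tendsto_of_tendsto_of_le_of_le tendsto_const_nhds h (fun _ => zero_le)
      fun n => (measure_mono fun ω hω => ?_).trans (measure_union_le _ _)
    by_contra hn
    simp only [Set.mem_union, Set.mem_ofPred_eq, not_or, not_not] at hn
    exact hω hn

variable {P : Measure Ω}

lemma eventually_highProb_iff {q : ℕ × Ω → Prop} :
    (∀ᶠ b in highProb P, q b) ↔ Tendsto (fun n => P {ω | ¬ q (n, ω)}) atTop (𝓝 0) :=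
  Iff.rfl

lemma tendstoInMeasure_const_iff_tendsto_highProb {E : Type*} [PseudoMetricSpace E]
    {X : ℕ → Ω → E} {c : E} :
    TendstoInMeasure P X atTop (fun _ => c) ↔
      Tendsto (fun b : ℕ × Ω => X b.1 b.2) (highProb P) (𝓝 c) := by
  rw [tendstoInMeasure_iff_dist, Metric.tendsto_nhds]
  simp only [eventually_highProb_iff, not_lt]

lemma tendsto_fst_highProb : Tendsto Prod.fst (highProb P) atTop := by
  intro S hS
  refine eventually_highProb_iff.2 (tendsto_const_nhds.congr' ?_)
  filter_upwards [hS] with n hn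
  simp [show n ∈ S from hn]

lemma eventually_highProb_of_ae {q : ℕ × Ω → Prop} (h : ∀ n, ∀ᵐ ω ∂P, q (n, ω)) :
    ∀ᶠ b in highProb P, q b := by
  refine eventually_highProb_iff.2 (tendsto_const_nhds.congr fun n => ?_)
  exact (ae_iff.1 (h n)).symm

/-- The way back from the filter to probabilities: `A n` lies in `B n` together with the exceptional
event, whose probability vanishes. -/
lemma eventually_measureReal_le_add [IsProbabilityMeasure P] {A B : ℕ → Set Ω}
    (h : ∀ᶠ b in highProb P, b.2 ∈ A b.1 → b.2 ∈ B b.1) {e : ℝ} (he : 0 < e) :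
    ∀ᶠ n in atTop, P.real (A n) ≤ P.real (B n) + e := by
  have h1 := (ENNReal.tendsto_toReal ENNReal.zero_ne_top).comp (eventually_highProb_iff.1 h)
  rw [ENNReal.toReal_zero] at h1
  filter_upwards [h1.eventually_lt_const he] with n hn
  refine (measureReal_mono fun ω hω => ?_).trans
    ((measureReal_union_le (B n) {ω | ¬ (ω ∈ A n → ω ∈ B n)}).trans
      (add_le_add le_rfl hn.le))
  by_cases hB : ω ∈ B n
  · exact Or.inl hB
  · exact Or.inr fun hAB => hB (hAB hω)

end HighProbability

/-! ### Portmanteau bounds and tightness -/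

section Portmanteau

variable {Ω : Type*} [MeasurableSpace Ω] {P : Measure Ω} [IsProbabilityMeasure P]
  {E : Type*} [PseudoMetricSpace E] [MeasurableSpace E] [BorelSpace E]
  {μ : Measure E} [IsProbabilityMeasure μ] {X : ℕ → Ω → E}

lemma MeasureTheory.TendstoInDistribution.eventually_measure_closed_lt
    (hX : TendstoInDistribution X atTop (id : E → E) (fun _ => P) μ) {F : Set E}
    (hF : IsClosed F) {y : ENNReal} (hy : μ F < y) :
    ∀ᶠ n in atTop, P {ω | X n ω ∈ F} < y := by
  have h := ProbabilityMeasure.limsup_measure_closed_le_of_tendsto hX.tendsto hF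
  have h' := eventually_lt_of_limsup_lt (h.trans_lt (by simpa using hy))
  filter_upwards [h'] with n hn
  have h2 := Measure.map_apply_of_aemeasurable (hX.forall_aemeasurable n) hF.measurableSet
  exact h2 ▸ hn

lemma MeasureTheory.TendstoInDistribution.eventually_measureReal_closed_lt
    (hX : TendstoInDistribution X atTop (id : E → E) (fun _ => P) μ) {F : Set E}
    (hF : IsClosed F) {y : ℝ} (hy : μ.real F < y) :
    ∀ᶠ n in atTop, P.real {ω | X n ω ∈ F} < y := by
  have hy' : μ F < ENNReal.ofReal y := (ENNReal.lt_ofReal_iff_toReal_lt (measure_ne_top _ _)).2 hy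
  filter_upwards [hX.eventually_measure_closed_lt hF hy'] with n hn
  exact (ENNReal.lt_ofReal_iff_toReal_lt (measure_ne_top _ _)).1 hn

lemma MeasureTheory.TendstoInDistribution.eventually_lt_measureReal_open
    (hX : TendstoInDistribution X atTop (id : E → E) (fun _ => P) μ) {U : Set E}
    (hU : IsOpen U) {y : ℝ} (hy : y < μ.real U) :
    ∀ᶠ n in atTop, y < P.real {ω | X n ω ∈ U} := by
  have h1 : μ.real Uᶜ < 1 - y := by
    rw [probReal_compl_eq_one_sub hU.measurableSet]
    linarith
  filter_upwards [hX.eventually_measureReal_closed_lt hU.isClosed_compl h1] with n hn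
  -- Subadditivity suffices here and needs no measurability of the preimages.
  have h2 : (1 : ℝ) ≤ P.real {ω | X n ω ∈ U} + P.real {ω | X n ω ∈ Uᶜ} := by
    have h3 := measureReal_union_le (μ := P) {ω | X n ω ∈ U} {ω | X n ω ∈ Uᶜ}
    have h4 : {ω | X n ω ∈ U} ∪ {ω | X n ω ∈ Uᶜ} = Set.univ := by
      ext ω
      simpa using em _
    rwa [h4, probReal_univ] at h3
  linarith

/-- A remainder that is negligible relative to a sequence converging in distribution tends to
zero in probability. -/
lemma MeasureTheory.TendstoInDistribution.tendsto_zero_of_isLittleO {E : Type*}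
    [NormedAddCommGroup E] [MeasurableSpace E] [BorelSpace E] [ProperSpace E]
    {μ : Measure E} [IsProbabilityMeasure μ] {X : ℕ → Ω → E}
    (hX : TendstoInDistribution X atTop (id : E → E) (fun _ => P) μ) {R : ℕ × Ω → ℝ}
    (hR : R =o[highProb P] fun b => X b.1 b.2) : Tendsto R (highProb P) (𝓝 0) := by
  rw [Metric.tendsto_nhds]
  intro η hη
  rw [eventually_highProb_iff, ENNReal.tendsto_nhds_zero]
  intro e he
  have he2 : 0 < e / 2 := ENNReal.half_pos he.ne'
  -- A single law is tight. Passing to `K + 1` gives a closed tail set and a positive bound, and the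
  -- little-o constant `η / (K + 1)` then keeps the remainder below `η`.
  obtain ⟨K, hK, hK0⟩ : ∃ K : ℝ, μ {z | K < ‖z‖} < e / 2 ∧ 0 ≤ K := by
    have h := tendsto_measure_norm_gt_of_isTightMeasureSet
      (isTightMeasureSet_singleton (μ := μ))
    simp only [Set.mem_singleton_iff, iSup_iSup_eq_left] at h
    exact ((h.eventually_lt_const he2).and (eventually_ge_atTop 0)).exists
  have hF : μ {z : E | K + 1 ≤ ‖z‖} < e / 2 :=
    (measure_mono fun z (hz : K + 1 ≤ ‖z‖) => by
      simp only [Set.mem_ofPred_eq]; linarith).trans_lt hK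
  have h1 := hX.eventually_measure_closed_lt
    (isClosed_le continuous_const continuous_norm) hF
  have h2 := ENNReal.tendsto_nhds_zero.1
    (eventually_highProb_iff.1 (hR.bound (show 0 < η / (K + 1) by positivity))) (e / 2) he2
  filter_upwards [h1, h2] with n hn1 hn2
  refine (measure_mono fun ω hω => ?_).trans ((measure_union_le _ _).trans
    ((add_le_add hn1.le hn2).trans_eq (ENNReal.add_halves e)))
  by_contra hcon
  rw [Set.mem_union, not_or] at hcon
  have hcon1 : ‖X n ω‖ < K + 1 := not_le.1 hcon.1
  have hcon2 : ‖R (n, ω)‖ ≤ η / (K + 1) * ‖X n ω‖ := not_not.1 hcon.2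
  refine hω ?_
  rw [dist_zero_right]
  calc ‖R (n, ω)‖ ≤ η / (K + 1) * ‖X n ω‖ := hcon2
    _ < η / (K + 1) * (K + 1) := mul_lt_mul_of_pos_left hcon1 (by positivity)
    _ = η := by field_simp

end Portmanteau

/-- Used with `a = √n`, which puts the error and the standard error on the scale where they have
limits. -/
lemma mem_confInterval_iff {k p : ℕ} {α : ℝ}
    {h : EuclideanSpace ℝ (Fin k) → EuclideanSpace ℝ (Fin p)}
    {r : EuclideanSpace ℝ (Fin k) → ℝ} {σ : Fin p → ℝ} {W : Matrix (Fin p) (Fin p) ℝ}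
    {θ : EuclideanSpace ℝ (Fin k)} {y a : ℝ} (ha : 0 < a) :
    y ∈ confInterval α h r σ W θ ↔
      |a * (r θ - y)| ≤ stdNormalQuantile (1 - α / 2) * (a * estimatedSE h r σ W θ) := by
  rw [abs_mul, abs_of_pos ha, mul_left_comm, mul_le_mul_iff_right₀ ha, abs_le, confInterval,
    Set.mem_Icc]
  constructor <;> rintro ⟨h1, h2⟩ <;> constructor <;> linarith

lemma tendsto_matrix_of_tendsto_entries {β ι κ : Type*} {l : Filter β} {A : β → Matrix ι κ ℝ}
    {A₀ : Matrix ι κ ℝ} (h : ∀ i j, Tendsto (fun b => A b i j) l (𝓝 (A₀ i j))) :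
    Tendsto A l (𝓝 A₀) :=
  tendsto_pi_nhds.2 fun i => tendsto_pi_nhds.2 fun j => h i j

lemma isSymm_of_posSemidef {ι : Type*} {A : Matrix ι ι ℝ} (hA : A.PosSemidef) : A.IsSymm := by
  have h := hA.isHermitian.eq
  rwa [conjTranspose_eq_transpose_of_trivial] at h

/-! ### Asymptotic linearity and coverage -/

namespace MomentMatchingRegularity

variable {Ω : Type*} [MeasurableSpace Ω] {P : Measure Ω} [IsProbabilityMeasure P]
  {k p : ℕ} {Θ : Set (EuclideanSpace ℝ (Fin k))} {θ₀ : EuclideanSpace ℝ (Fin k)}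
  {h : EuclideanSpace ℝ (Fin k) → EuclideanSpace ℝ (Fin p)}
  {r : EuclideanSpace ℝ (Fin k) → ℝ} {V W : Matrix (Fin p) (Fin p) ℝ}
  {μhat : ℕ → Ω → EuclideanSpace ℝ (Fin p)} {σhat : ℕ → Ω → Fin p → ℝ}
  {What : ℕ → Ω → Matrix (Fin p) (Fin p) ℝ} {θhat : ℕ → Ω → EuclideanSpace ℝ (Fin k)}

lemma tendsto_θhat (hreg : MomentMatchingRegularity P Θ θ₀ h r V W μhat σhat What θhat) :
    Tendsto (fun b : ℕ × Ω => θhat b.1 b.2) (highProb P) (𝓝 θ₀) :=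
  tendstoInMeasure_const_iff_tendsto_highProb.1 hreg.θhat_consistent

lemma tendsto_What (hreg : MomentMatchingRegularity P Θ θ₀ h r V W μhat σhat What θhat) :
    Tendsto (fun b : ℕ × Ω => What b.1 b.2) (highProb P) (𝓝 W) := by
  refine tendsto_matrix_of_tendsto_entries fun i j => ?_
  have h := hreg.What_consistent i j
  rwa [tendstoInMeasure_const_iff_tendsto_highProb] at h

lemma tendsto_estimatedSE (hreg : MomentMatchingRegularity P Θ θ₀ h r V W μhat σhat What θhat) :
    Tendsto (fun b : ℕ × Ω =>
        √(b.1 : ℝ) * estimatedSE h r (σhat b.1 b.2) (What b.1 b.2) (θhat b.1 b.2)) (highProb P)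
      (𝓝 (worstCaseSE (fun j => √(V j j))
        (momentLoadings W (jacobianMatrix h θ₀) (gradientVector r θ₀)))) := by
  have hx := tendsto_momentLoadings hreg.tendsto_What
    (hreg.h_contDiffAt.continuousAt_jacobianMatrix.tendsto.comp hreg.tendsto_θhat)
    (hreg.r_contDiffAt.continuousAt_gradientVector.tendsto.comp hreg.tendsto_θhat)
    hreg.nonsingular
  simp only [estimatedSE, worstCaseSE, Finset.mul_sum, ← mul_assoc]
  exact tendsto_finsetSum _ fun j _ =>
    (tendstoInMeasure_const_iff_tendsto_highProb.1 (hreg.σhat_consistent j)).mul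
      (tendsto_pi_nhds.1 hx j).abs

/-- A minimizer over `Θ` satisfies the first-order condition once it is interior and `h` is
differentiable there; consistency makes this hold with probability tending to one. -/
lemma eventually_firstOrderCondition
    (hreg : MomentMatchingRegularity P Θ θ₀ h r V W μhat σhat What θhat) :
    ∀ᶠ b : ℕ × Ω in highProb P, (jacobianMatrix h (θhat b.1 b.2))ᵀ *ᵥ
      (What b.1 b.2 *ᵥ (μhat b.1 b.2 - h (θhat b.1 b.2)).ofLp) = 0 := by
  have hdiff : ∀ᶠ θ in 𝓝 θ₀, DifferentiableAt ℝ h θ := by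
    filter_upwards [hreg.h_contDiffAt.eventually (by simp)] with θ hθ
      using hθ.differentiableAt one_ne_zero
  filter_upwards [eventually_highProb_of_ae (q := fun b => θhat b.1 b.2 ∈ Θ ∧
      IsMinOn (minDistObjective h (μhat b.1 b.2) (What b.1 b.2)) Θ (θhat b.1 b.2))
      hreg.θhat_argmin, hreg.tendsto_θhat.eventually hdiff,
    hreg.tendsto_θhat.eventually (isOpen_interior.mem_nhds hreg.θ₀_interior)] with b hmin hd hint
  exact jacobianMatrix_transpose_mulVec_eq_zero (hreg.What_isSymm b.1 b.2) hd
    (hmin.2.isLocalMin (mem_interior_iff_mem_nhds.1 hint))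

/-- Asymptotic linearity: the scaled estimation error of `r(θhat)` is the linear combination of
the scaled moment errors with weights `x`, up to a remainder that vanishes in probability. -/
lemma tendsto_linearization_error
    (hreg : MomentMatchingRegularity P Θ θ₀ h r V W μhat σhat What θhat) :
    Tendsto (fun b : ℕ × Ω => √(b.1 : ℝ) * (r (θhat b.1 b.2) - r θ₀) -
        momentLoadings W (jacobianMatrix h θ₀) (gradientVector r θ₀) ⬝ᵥ
          (√(b.1 : ℝ) • (μhat b.1 b.2 - h θ₀)).ofLp) (highProb P) (𝓝 0) := by
  have hlin := minDist_sub_isLittleO hreg.h_contDiffAt hreg.r_contDiffAt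
    (isSymm_of_posSemidef hreg.W_posSemidef) hreg.nonsingular hreg.tendsto_θhat
    hreg.tendsto_What hreg.eventually_firstOrderCondition
  refine hreg.asymptotically_normal.tendsto_zero_of_isLittleO ?_
  refine ((isBigO_refl (fun b : ℕ × Ω => √(b.1 : ℝ)) (highProb P)).smul_isLittleO hlin).congr_left
    fun b => ?_
  rw [WithLp.ofLp_smul, dotProduct_smul, smul_eq_mul, smul_eq_mul, mul_sub]

variable {α : ℝ} {x : Fin p → ℝ}

lemma eventually_mem_confInterval
    (hreg : MomentMatchingRegularity P Θ θ₀ h r V W μhat σhat What θhat)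
    (hx : x = momentLoadings W (jacobianMatrix h θ₀) (gradientVector r θ₀))
    (hc : 0 < worstCaseSE (fun j => √(V j j)) x) {t : ℝ}
    (ht : t < stdNormalQuantile (1 - α / 2)) :
    ∀ᶠ b : ℕ × Ω in highProb P,
      |x ⬝ᵥ (√(b.1 : ℝ) • (μhat b.1 b.2 - h θ₀)).ofLp| < t * worstCaseSE (fun j => √(V j j)) x →
        r θ₀ ∈ confInterval α h r (σhat b.1 b.2) (What b.1 b.2) (θhat b.1 b.2) := by
  -- The limit is `q c`; the strict gap above `t c` absorbs both the linearization error and the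
  -- error in the standard error.
  have hlim := (hreg.tendsto_estimatedSE.const_mul (stdNormalQuantile (1 - α / 2))).sub
    hreg.tendsto_linearization_error.abs
  rw [← hx, abs_zero, sub_zero] at hlim
  filter_upwards [hlim.eventually_const_lt (mul_lt_mul_of_pos_right ht hc),
    tendsto_fst_highProb.eventually (eventually_gt_atTop 0)] with b hb hn hlt
  rw [mem_confInterval_iff (Real.sqrt_pos.2 (Nat.cast_pos.2 hn))]
  have := abs_sub_abs_le_abs_sub (√(b.1 : ℝ) * (r (θhat b.1 b.2) - r θ₀))
    (x ⬝ᵥ (√(b.1 : ℝ) • (μhat b.1 b.2 - h θ₀)).ofLp)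
  linarith

lemma eventually_of_mem_confInterval
    (hreg : MomentMatchingRegularity P Θ θ₀ h r V W μhat σhat What θhat)
    (hx : x = momentLoadings W (jacobianMatrix h θ₀) (gradientVector r θ₀))
    (hc : 0 < worstCaseSE (fun j => √(V j j)) x) {t : ℝ}
    (ht : stdNormalQuantile (1 - α / 2) < t) :
    ∀ᶠ b : ℕ × Ω in highProb P,
      r θ₀ ∈ confInterval α h r (σhat b.1 b.2) (What b.1 b.2) (θhat b.1 b.2) →
        |x ⬝ᵥ (√(b.1 : ℝ) • (μhat b.1 b.2 - h θ₀)).ofLp| ≤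
          t * worstCaseSE (fun j => √(V j j)) x := by
  have hlim := (hreg.tendsto_estimatedSE.const_mul (stdNormalQuantile (1 - α / 2))).add
    hreg.tendsto_linearization_error.abs
  rw [← hx, abs_zero, add_zero] at hlim
  filter_upwards [hlim.eventually_lt_const (mul_lt_mul_of_pos_right ht hc),
    tendsto_fst_highProb.eventually (eventually_gt_atTop 0)] with b hb hn hmem
  rw [mem_confInterval_iff (Real.sqrt_pos.2 (Nat.cast_pos.2 hn))] at hmem
  have := abs_sub_abs_le_abs_sub (x ⬝ᵥ (√(b.1 : ℝ) • (μhat b.1 b.2 - h θ₀)).ofLp)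
    (√(b.1 : ℝ) * (r (θhat b.1 b.2) - r θ₀))
  rw [abs_sub_comm] at this
  linarith

lemma multivariateGaussian_real_dotProduct_preimage (hV : V.PosSemidef) (x : Fin p → ℝ)
    {S : Set ℝ} (hS : MeasurableSet S) :
    (multivariateGaussian 0 V).real {z | x ⬝ᵥ z.ofLp ∈ S} =
      (gaussianReal 0 1).real {z | √(x ⬝ᵥ (V *ᵥ x)) * z ∈ S} := by
  have hcont : Continuous fun z : EuclideanSpace ℝ (Fin p) => x ⬝ᵥ z.ofLp := by fun_prop
  have h := congrArg (fun ν : Measure ℝ => ν.real S) (multivariateGaussian_map_dotProduct hV x)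
  simp only at h
  rwa [map_measureReal_apply hcont.measurable hS, map_measureReal_apply (by fun_prop) hS] at h

lemma lt_coverage (hreg : MomentMatchingRegularity P Θ θ₀ h r V W μhat σhat What θhat)
    (hx : x = momentLoadings W (jacobianMatrix h θ₀) (gradientVector r θ₀))
    (hα : α ∈ Set.Ioo (0 : ℝ) 1) (hc : 0 < worstCaseSE (fun j => √(V j j)) x) {y : ℝ}
    (hy : y < 1 - α) :
    ∀ᶠ n in atTop,
      y < P.real {ω | r θ₀ ∈ confInterval α h r (σhat n ω) (What n ω) (θhat n ω)} := by
  set q := stdNormalQuantile (1 - α / 2)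
  set c := worstCaseSE (fun j => √(V j j)) x
  have hq : cdf (gaussianReal 0 1) q = 1 - α / 2 :=
    cdf_stdNormalQuantile ⟨by linarith [hα.2], by linarith [hα.1]⟩
  have hq0 : 0 < q := stdNormalQuantile_pos hα
  -- Continuity of `Φ` at `q`, where `2Φ(q) - 1 = 1 - α`, leaves room for some `t < q`.
  obtain ⟨t, ht, ht0, htq⟩ : ∃ t, y < 2 * cdf (gaussianReal 0 1) t - 1 ∧ 0 < t ∧ t < q := by
    have hcont : Continuous fun t => 2 * cdf (gaussianReal 0 1) t - 1 :=
      ((continuous_cdf _).const_mul 2).sub continuous_const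
    have h1 : ∀ᶠ t in 𝓝[<] q, y < 2 * cdf (gaussianReal 0 1) t - 1 :=
      ((hcont.tendsto q).mono_left nhdsWithin_le_nhds).eventually_const_lt
        (by rw [hq]; linarith)
    exact (h1.and (Ioo_mem_nhdsLT hq0)).exists
  have hopen : IsOpen {z : EuclideanSpace ℝ (Fin p) | x ⬝ᵥ z.ofLp ∈ Set.Ioo (-(t * c)) (t * c)} :=
    isOpen_Ioo.preimage (by fun_prop)
  have hle : 2 * cdf (gaussianReal 0 1) t - 1 ≤
      (multivariateGaussian 0 V).real {z | x ⬝ᵥ z.ofLp ∈ Set.Ioo (-(t * c)) (t * c)} := by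
    rw [multivariateGaussian_real_dotProduct_preimage hreg.V_posSemidef x measurableSet_Ioo,
      ← stdNormal_real_Ioo t ht0.le]
    refine measureReal_mono fun z hz => ?_
    have hz' : |z| < t := abs_lt.2 hz
    refine abs_lt.1 ?_
    rw [abs_mul, abs_of_nonneg (Real.sqrt_nonneg _), mul_comm t]
    exact (mul_le_mul_of_nonneg_right (sqrt_quadraticForm_le_worstCaseSE hreg.V_posSemidef)
      (abs_nonneg z)).trans_lt (mul_lt_mul_of_pos_left hz' hc)
  -- The slack `y' - y` pays for the exceptional event.
  obtain ⟨y', hyy', hy't⟩ := exists_between (ht.trans_le hle)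
  filter_upwards [hreg.asymptotically_normal.eventually_lt_measureReal_open hopen hy't,
    eventually_measureReal_le_add
      (A := fun n => {ω | x ⬝ᵥ (√(n : ℝ) • (μhat n ω - h θ₀)).ofLp ∈ Set.Ioo (-(t * c)) (t * c)})
      (B := fun n => {ω | r θ₀ ∈ confInterval α h r (σhat n ω) (What n ω) (θhat n ω)})
      ((hreg.eventually_mem_confInterval hx hc htq).mono fun b hb hA => hb (abs_lt.2 hA))
      (sub_pos.2 hyy')] with n h1 h2
  have h3 := h1.trans_le h2
  linarith

lemma coverage_lt (hreg : MomentMatchingRegularity P Θ θ₀ h r V W μhat σhat What θhat)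
    (hx : x = momentLoadings W (jacobianMatrix h θ₀) (gradientVector r θ₀))
    (hα : α ∈ Set.Ioo (0 : ℝ) 1) (hc : 0 < worstCaseSE (fun j => √(V j j)) x)
    (hmax : √(x ⬝ᵥ (V *ᵥ x)) = worstCaseSE (fun j => √(V j j)) x) {y : ℝ} (hy : 1 - α < y) :
    ∀ᶠ n in atTop,
      P.real {ω | r θ₀ ∈ confInterval α h r (σhat n ω) (What n ω) (θhat n ω)} < y := by
  set q := stdNormalQuantile (1 - α / 2)
  set c := worstCaseSE (fun j => √(V j j)) x
  have hq : cdf (gaussianReal 0 1) q = 1 - α / 2 :=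
    cdf_stdNormalQuantile ⟨by linarith [hα.2], by linarith [hα.1]⟩
  have hq0 : 0 < q := stdNormalQuantile_pos hα
  obtain ⟨t, ht, htq⟩ : ∃ t, 2 * cdf (gaussianReal 0 1) t - 1 < y ∧ q < t := by
    have hcont : Continuous fun t => 2 * cdf (gaussianReal 0 1) t - 1 :=
      ((continuous_cdf _).const_mul 2).sub continuous_const
    have h1 : ∀ᶠ t in 𝓝[>] q, 2 * cdf (gaussianReal 0 1) t - 1 < y :=
      ((hcont.tendsto q).mono_left nhdsWithin_le_nhds).eventually_lt_const
        (by rw [hq]; linarith)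
    exact (h1.and self_mem_nhdsWithin).exists
  have hclosed :
      IsClosed {z : EuclideanSpace ℝ (Fin p) | x ⬝ᵥ z.ofLp ∈ Set.Icc (-(t * c)) (t * c)} :=
    isClosed_Icc.preimage (by fun_prop)
  have hle : (multivariateGaussian 0 V).real {z | x ⬝ᵥ z.ofLp ∈ Set.Icc (-(t * c)) (t * c)} ≤
      2 * cdf (gaussianReal 0 1) t - 1 := by
    rw [multivariateGaussian_real_dotProduct_preimage hreg.V_posSemidef x measurableSet_Icc,
      ← stdNormal_real_Ioo t (hq0.trans htq).le, measureReal_congr Ioo_ae_eq_Icc]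
    refine measureReal_mono fun z hz => abs_le.1 ?_
    have hz' := abs_le.2 hz
    -- Maximality of `V` enters only here: with `√(x'Vx) = c > 0` the factor `c` cancels.
    rw [hmax, abs_mul, abs_of_pos hc, mul_comm t] at hz'
    exact le_of_mul_le_mul_left hz' hc
  obtain ⟨y', hy't, hyy'⟩ := exists_between (hle.trans_lt ht)
  filter_upwards [hreg.asymptotically_normal.eventually_measureReal_closed_lt hclosed hy't,
    eventually_measureReal_le_add
      (A := fun n => {ω | r θ₀ ∈ confInterval α h r (σhat n ω) (What n ω) (θhat n ω)})
      (B := fun n => {ω | x ⬝ᵥ (√(n : ℝ) • (μhat n ω - h θ₀)).ofLp ∈ Set.Icc (-(t * c)) (t * c)})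
      ((hreg.eventually_of_mem_confInterval hx hc htq).mono fun b hb hA => abs_le.1 (hb hA))
      (sub_pos.2 hyy')] with n h1 h2
  have h3 := h2.trans_lt (add_lt_add_of_lt_of_le h1 le_rfl)
  linarith

lemma tendsto_coverage (hreg : MomentMatchingRegularity P Θ θ₀ h r V W μhat σhat What θhat)
    (hx : x = momentLoadings W (jacobianMatrix h θ₀) (gradientVector r θ₀))
    (hα : α ∈ Set.Ioo (0 : ℝ) 1) (hc : 0 < worstCaseSE (fun j => √(V j j)) x)
    (hmax : √(x ⬝ᵥ (V *ᵥ x)) = worstCaseSE (fun j => √(V j j)) x) :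
    Tendsto (fun n =>
      P.real {ω | r θ₀ ∈ confInterval α h r (σhat n ω) (What n ω) (θhat n ω)})
      atTop (𝓝 (1 - α)) :=
  tendsto_order.2 ⟨fun _ hy => hreg.lt_coverage hx hα hc hy,
    fun _ hy => hreg.coverage_lt hx hα hc hmax hy⟩

end MomentMatchingRegularity

/-! ### The main theorem -/

theorem mainTheorem5 {Ω : Type*} [MeasurableSpace Ω] (P : Measure Ω) [IsProbabilityMeasure P]
    {k p : ℕ} (Θ : Set (EuclideanSpace ℝ (Fin k))) (θ₀ : EuclideanSpace ℝ (Fin k))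
    (h : EuclideanSpace ℝ (Fin k) → EuclideanSpace ℝ (Fin p))
    (r : EuclideanSpace ℝ (Fin k) → ℝ) (V W : Matrix (Fin p) (Fin p) ℝ)
    (μhat : ℕ → Ω → EuclideanSpace ℝ (Fin p)) (σhat : ℕ → Ω → Fin p → ℝ)
    (What : ℕ → Ω → Matrix (Fin p) (Fin p) ℝ) (θhat : ℕ → Ω → EuclideanSpace ℝ (Fin k))
    (hreg : MomentMatchingRegularity P Θ θ₀ h r V W μhat σhat What θhat)
    (x : Fin p → ℝ)
    (hx : x = momentLoadings W (jacobianMatrix h θ₀) (gradientVector r θ₀))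
    (α : ℝ) (hα : α ∈ Set.Ioo (0 : ℝ) 1) :
    TendstoInMeasure P
        (fun (n : ℕ) ω => √(n : ℝ) * estimatedSE h r (σhat n ω) (What n ω) (θhat n ω)) atTop
        (fun _ => worstCaseSE (fun j => √(V j j)) x) ∧
      IsGreatest ((fun V' => √(x ⬝ᵥ (V' *ᵥ x))) '' sameDiagPosSemidef V)
        (worstCaseSE (fun j => √(V j j)) x) ∧
      (0 < worstCaseSE (fun j => √(V j j)) x →
        1 - α ≤ liminf (fun n =>
            P.real {ω | r θ₀ ∈ confInterval α h r (σhat n ω) (What n ω) (θhat n ω)}) atTop ∧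
        (√(x ⬝ᵥ (V *ᵥ x)) = worstCaseSE (fun j => √(V j j)) x →
          Tendsto (fun n =>
            P.real {ω | r θ₀ ∈ confInterval α h r (σhat n ω) (What n ω) (θhat n ω)})
            atTop (𝓝 (1 - α))) ∧
        (IsWorstCaseRankOne V x →
          Tendsto (fun n =>
            P.real {ω | r θ₀ ∈ confInterval α h r (σhat n ω) (What n ω) (θhat n ω)})
            atTop (𝓝 (1 - α)))) := by
  refine ⟨?_, isGreatest_worstCaseSE hreg.V_posSemidef, fun hc => ⟨?_, ?_, ?_⟩⟩
  · rw [hx]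
    exact tendstoInMeasure_const_iff_tendsto_highProb.2 hreg.tendsto_estimatedSE
  · refine le_of_forall_lt fun y hy => ?_
    obtain ⟨y', hyy', hy'⟩ := exists_between hy
    -- The real `liminf` is a supremum of eventual lower bounds; coverage being at most `1` keeps
    -- that set bounded above.
    exact hyy'.trans_le (le_liminf_of_le
      (isBoundedUnder_of ⟨1, fun _ => measureReal_le_one⟩).isCoboundedUnder_ge
      ((hreg.lt_coverage hx hα hc hy').mono fun _ hn => hn.le))
  · exact fun hmax => hreg.tendsto_coverage hx hα hc hmax
  · exact fun hrank => hreg.tendsto_coverage hx hα hc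
      (sqrt_quadraticForm_eq_of_isWorstCaseRankOne hrank)
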